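/- Let $\mathbb F$ be $\mathbb R$ or $\mathbb C$. The split interval (double arrow space) $\ddot{\mathbb I}$ is the set $[0,1]\times\{0,1\}$ with the order topology of the lexicographic order, in which $(x,i)\le(y,j)$ if and only if $x<y$, or $x=y$ and $i\le j$; it is compact. Let $C(\ddot{\mathbb I})$ be the Banach space of continuous functions $\ddot{\mathbb I}\to\mathbb F$ with the supremum norm. A bounded subset $B$ of a Banach space $E$ over $\mathbb F$ is called \emph{limited} if $\lim_{n}\sup_{x\in B}|\chi_n(x)|=0$ for every weak$^*$ null sequence $(\chi_n)$ in the dual space $E'$. The space $E$ is \emph{Gelfand–Phillips} if every limited set in $E$ has compact closure. The space $E$ has the \emph{separable $c_0$-extension property} if every continuous linear operator $T:X\to c_0$ defined on a separable closed linear subspace $X\subseteq E$ can be extended to a continuous linear operator $\bar T:E\to c_0$, where $c_0$ is the Banach space of sequences in $\mathbb F$ that converge to $0$, with the supremum norm. Then the Banach space $C(\ddot{\mathbb I})$ is Gelfand–Phillips, but it does not have the separable $c_0$-extension property. -/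

import Mathlib

open Filter Topology
open scoped ZeroAtInfty

/-- The split interval (double arrow space): the set `[0,1] × {0,1}`, with the lexicographic order
and the order topology. -/
def SplitInterval : Type := Lex (Set.Icc (0 : ℝ) 1 × Fin 2)

namespace SplitInterval

noncomputable instance : LinearOrder SplitInterval :=
  inferInstanceAs (LinearOrder (Lex (Set.Icc (0 : ℝ) 1 × Fin 2)))

/-- The topology generated by the open rays of the lexicographic order. -/
noncomputable instance : TopologicalSpace SplitInterval := Preorder.topology SplitInterval

instance : OrderTopology SplitInterval := ⟨rfl⟩

/-- The point `(x, i)` of the split interval. -/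
def mk (x : Set.Icc (0 : ℝ) 1) (i : Fin 2) : SplitInterval := toLex (x, i)

theorem mk_le_mk {x y : Set.Icc (0 : ℝ) 1} {i j : Fin 2} :
    mk x i ≤ mk y j ↔ x < y ∨ (x = y ∧ i ≤ j) :=
  Prod.Lex.toLex_le_toLex

theorem exists_eq_mk (p : SplitInterval) : ∃ x i, p = mk x i :=
  ⟨(ofLex p).1, (ofLex p).2, rfl⟩

theorem exists_isLUB (S : Set SplitInterval) : ∃ p, IsLUB S p := by
  classical
  let A : Set (Set.Icc (0 : ℝ) 1) := {x | ∃ i, mk x i ∈ S}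
  have hA : IsLUB A (sSup A) := isLUB_sSup A
  by_cases h1 : mk (sSup A) 1 ∈ S
  · refine ⟨mk (sSup A) 1, ?_, fun q hq => hq h1⟩
    intro q hq
    obtain ⟨x, i, rfl⟩ := exists_eq_mk q
    rw [mk_le_mk]
    rcases (hA.1 (show x ∈ A from ⟨i, hq⟩)).lt_or_eq with h | h
    · exact Or.inl h
    · exact Or.inr ⟨h, by omega⟩
  · refine ⟨mk (sSup A) 0, ?_, ?_⟩
    · intro q hq
      obtain ⟨x, i, rfl⟩ := exists_eq_mk q
      rw [mk_le_mk]
      rcases (hA.1 (show x ∈ A from ⟨i, hq⟩)).lt_or_eq with h | h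
      · exact Or.inl h
      · refine Or.inr ⟨h, ?_⟩
        have hi : i ≠ 1 := by
          rintro rfl
          exact h1 (h ▸ hq)
        omega
    · intro q hq
      obtain ⟨y, j, rfl⟩ := exists_eq_mk q
      have hy : sSup A ≤ y := by
        refine hA.2 ?_
        rintro x ⟨i, hi⟩
        rcases mk_le_mk.1 (hq hi) with h | h
        · exact h.le
        · exact h.1.le
      rw [mk_le_mk]
      rcases hy.lt_or_eq with h | h
      · exact Or.inl h
      · exact Or.inr ⟨h, by omega⟩

instance : CompactSpace SplitInterval := by
  classical
  choose s hs using exists_isLUB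
  let _ : SupSet SplitInterval := ⟨s⟩
  let _ : CompleteLattice SplitInterval :=
    { completeLatticeOfSup SplitInterval hs with
      sup := max
      inf := min
      le_sup_left := le_max_left
      le_sup_right := le_max_right
      sup_le := fun _ _ _ => max_le
      inf_le_left := min_le_left
      inf_le_right := min_le_right
      le_inf := fun _ _ _ => le_min }
  let _ : ConditionallyCompleteLinearOrder SplitInterval :=
    { (inferInstance : LinearOrder SplitInterval),
      (inferInstance : ConditionallyCompleteLattice SplitInterval) with
      csSup_of_not_bddAbove := fun S hS => absurd (OrderTop.bddAbove S) hS
      csInf_of_not_bddBelow := fun S hS => absurd (OrderBot.bddBelow S) hS }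
  refine ⟨?_⟩
  have h : IsCompact (Set.Icc (⊥ : SplitInterval) ⊤) :=
    ConditionallyCompleteLinearOrder.isCompact_Icc _ _
  rwa [Set.Icc_bot_top] at h

end SplitInterval

section BanachSpaceProperties

variable (𝕜 : Type*) [RCLike 𝕜] {E : Type*} [NormedAddCommGroup E] [NormedSpace 𝕜 E]

/-- A set `B` in a normed space is limited if it is bounded and every weak* null sequence
`χ₀, χ₁, …` in the dual converges to `0` uniformly on `B`:
`sup {|χₙ x| : x ∈ B} → 0` as `n → ∞`. -/
def IsLimitedSet (B : Set E) : Prop :=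
  Bornology.IsBounded B ∧
    ∀ χ : ℕ → WeakDual 𝕜 E, Tendsto χ atTop (𝓝 0) →
      Tendsto (fun n => sSup ((fun x => ‖χ n x‖) '' B)) atTop (𝓝 0)

variable (E)

/-- `E` is Gelfand–Phillips if every limited set in `E` has compact closure. -/
def IsGelfandPhillips : Prop :=
  ∀ B : Set E, IsLimitedSet 𝕜 B → IsCompact (closure B)

/-- `E` has the separable `c₀`-extension property if every operator `X → c₀` on a separable closed
linear subspace `X` of `E` extends to an operator `E → c₀`. Here `c₀` is `C₀(ℕ, 𝕜)`, the space of
scalar sequences tending to `0` with the supremum norm. -/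
def HasSeparableC0ExtensionProperty : Prop :=
  ∀ X : Submodule 𝕜 E, IsClosed (X : Set E) → TopologicalSpace.SeparableSpace X →
    ∀ T : X →L[𝕜] C₀(ℕ, 𝕜), ∃ T' : E →L[𝕜] C₀(ℕ, 𝕜), ∀ x : X, T' (x : E) = T x

end BanachSpaceProperties

/-! ### Topology of the split interval -/

namespace SplitInterval

/-! Gelfand–Phillips: the split interval is first countable, so if a limited set fails to be
equicontinuous at `t`, a sequence `s n → t` witnesses it, and the weak* null functionals `δ_(s n) -
δ_t` contradict limitedness. Arzelà–Ascoli then gives compactness.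

Extension: let `X` be the copy of `C[0,1]` pulled back along the projection and `T g = (g (p n) - g
(q n))`, for shrinking intervals `[p n, q n)` that cover each `x < 1` infinitely often. The
coordinates of an extension differ from `δ_(p n, 0) - δ_(q n, 0)` by functionals `ρ n` killing `X`.
Modulo `X`, the indicators of the sets `Iic (x, 0)` behave like unit vectors of a `c₀`-space, so
each `ρ n` is nonzero on only countably many (`sum_norm_apply_indicatorIic_le`). For some `x < 1`
all `ρ n` vanish, and the image of its indicator has coordinate `1` infinitely often, so it is not
in `c₀`. -/

theorem mk_lt_mk {x y : Set.Icc (0 : ℝ) 1} {i j : Fin 2} :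
    mk x i < mk y j ↔ x < y ∨ (x = y ∧ i < j) :=
  Prod.Lex.toLex_lt_toLex

/-- The projection of the split interval onto the unit interval. -/
def proj (p : SplitInterval) : Set.Icc (0 : ℝ) 1 := (ofLex p).1

@[simp]
theorem proj_mk (x : Set.Icc (0 : ℝ) 1) (i : Fin 2) : proj (mk x i) = x := rfl

theorem lt_mk_zero_iff {z : SplitInterval} {x : Set.Icc (0 : ℝ) 1} :
    z < mk x 0 ↔ proj z < x := by
  obtain ⟨y, i, rfl⟩ := exists_eq_mk z
  simp [mk_lt_mk]

theorem mk_one_lt_iff {z : SplitInterval} {x : Set.Icc (0 : ℝ) 1} :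
    mk x 1 < z ↔ x < proj z := by
  obtain ⟨y, i, rfl⟩ := exists_eq_mk z
  rw [mk_lt_mk, proj_mk]
  exact ⟨fun h => h.elim id fun h => absurd h.2 (by omega), Or.inl⟩

theorem lt_mk_one_iff {z : SplitInterval} {x : Set.Icc (0 : ℝ) 1} :
    z < mk x 1 ↔ z ≤ mk x 0 := by
  obtain ⟨y, i, rfl⟩ := exists_eq_mk z
  rw [mk_lt_mk, mk_le_mk]
  have : i < 1 ↔ i ≤ 0 := by omega
  rw [this]

theorem continuous_proj : Continuous proj := by
  refine OrderTopology.continuous_iff.2 fun x => ⟨?_, ?_⟩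
  · convert! isOpen_Ioi (a := mk x 1) using 1
    ext z
    exact mk_one_lt_iff.symm
  · convert! isOpen_Iio (a := mk x 0) using 1
    ext z
    exact lt_mk_zero_iff.symm

theorem isClopen_Iic_mk_zero (x : Set.Icc (0 : ℝ) 1) : IsClopen (Set.Iic (mk x 0)) := by
  refine ⟨isClosed_Iic, ?_⟩
  convert! isOpen_Iio (a := mk x 1) using 1
  ext z
  exact lt_mk_one_iff.symm

/-- This form makes the neighbourhood filter visibly countably generated. -/
theorem nhds_mk_zero (x : Set.Icc (0 : ℝ) 1) :
    𝓝 (mk x 0) = comap proj (𝓝 x) ⊓ 𝓟 (Set.Iic (mk x 0)) := by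
  refine le_antisymm (le_inf (tendsto_iff_comap.1 (continuous_proj.tendsto _))
    (le_principal_iff.2 ((isClopen_Iic_mk_zero x).isOpen.mem_nhds Set.self_mem_Iic))) ?_
  rw [nhds_eq_order (mk x 0)]
  refine le_inf (le_iInf₂ fun b hb => le_principal_iff.2 ?_)
    (le_iInf₂ fun b hb => le_principal_iff.2 ?_)
  · refine mem_inf_of_left ⟨Set.Ioi (proj b), Ioi_mem_nhds (lt_mk_zero_iff.1 hb), fun z hz => ?_⟩
    obtain ⟨y, i, rfl⟩ := exists_eq_mk b
    obtain ⟨w, j, rfl⟩ := exists_eq_mk z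
    exact mk_lt_mk.2 (Or.inl hz)
  · exact mem_inf_of_right fun z hz =>
      lt_of_le_of_lt (Set.mem_Iic.1 hz) (Set.mem_Ioi.1 hb)

theorem nhds_mk_one (x : Set.Icc (0 : ℝ) 1) :
    𝓝 (mk x 1) = comap proj (𝓝 x) ⊓ 𝓟 (Set.Iic (mk x 0))ᶜ := by
  have hx : mk x 1 ∈ (Set.Iic (mk x 0))ᶜ := fun h => lt_irrefl _ (lt_mk_one_iff.2 h)
  refine le_antisymm (le_inf (tendsto_iff_comap.1 (continuous_proj.tendsto _))
    (le_principal_iff.2 ((isClopen_Iic_mk_zero x).compl.isOpen.mem_nhds hx))) ?_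
  rw [nhds_eq_order (mk x 1)]
  refine le_inf (le_iInf₂ fun b hb => le_principal_iff.2 ?_)
    (le_iInf₂ fun b hb => le_principal_iff.2 ?_)
  · exact mem_inf_of_right fun z hz =>
      lt_of_lt_of_le hb (not_lt.1 fun h => hz (lt_mk_one_iff.1 h))
  · refine mem_inf_of_left ⟨Set.Iio (proj b), Iio_mem_nhds (mk_one_lt_iff.1 hb), fun z hz => ?_⟩
    obtain ⟨y, i, rfl⟩ := exists_eq_mk b
    obtain ⟨w, j, rfl⟩ := exists_eq_mk z
    exact mk_lt_mk.2 (Or.inl hz)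

instance : FirstCountableTopology SplitInterval := by
  refine ⟨fun p => ?_⟩
  obtain ⟨x, i, rfl⟩ := exists_eq_mk p
  fin_cases i
  · exact nhds_mk_zero x ▸ inferInstance
  · exact nhds_mk_one x ▸ inferInstance

end SplitInterval

/-! ### The Gelfand–Phillips property -/

section Limited

variable {𝕜 : Type*} [RCLike 𝕜]

/-- A limited set of continuous functions on a first-countable compact space is equicontinuous. -/
theorem IsLimitedSet.equicontinuous {K : Type*} [TopologicalSpace K] [CompactSpace K]
    [FirstCountableTopology K] {B : Set C(K, 𝕜)} (hB : IsLimitedSet 𝕜 B) :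
    Equicontinuous (fun (f : B) (t : K) => (f : C(K, 𝕜)) t) := by
  intro t
  by_contra h
  rw [Metric.equicontinuousAt_iff_right] at h
  push Not at h
  obtain ⟨ε, hε, h⟩ := h
  obtain ⟨s, hs, hfs⟩ := exists_seq_forall_of_frequently h
  choose f hf using hfs
  let χ : ℕ → WeakDual 𝕜 C(K, 𝕜) := fun n => StrongDual.toWeakDual
    (ContinuousMap.evalCLM 𝕜 (s n) - ContinuousMap.evalCLM 𝕜 t)
  have hχ : ∀ n g, χ n g = g (s n) - g t := fun n g => rfl
  have hχ0 : Tendsto χ atTop (𝓝 0) := by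
    refine tendsto_iff_forall_eval_tendsto_topDualPairing.2 fun g => ?_
    have := ((g.continuous.tendsto t).comp hs).sub_const (g t)
    rw [sub_self] at this
    exact this
  obtain ⟨C, hC⟩ := hB.1.exists_norm_le
  have hlim := hB.2 χ hχ0
  obtain ⟨n, hn⟩ := (hlim.eventually (gt_mem_nhds hε)).exists
  refine hn.not_ge ((hf n).trans ?_)
  -- The bound `C + C` matters: the real `sSup` of an unbounded set is `0`.
  refine le_csSup ⟨C + C, ?_⟩ ⟨f n, (f n).2, ?_⟩
  · rintro _ ⟨g, hg, rfl⟩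
    simp only [hχ]
    exact (norm_sub_le _ _).trans (add_le_add ((g.norm_coe_le_norm _).trans (hC g hg))
      ((g.norm_coe_le_norm _).trans (hC g hg)))
  · simp only [hχ]
    rw [dist_eq_norm_sub']

/-- The space of continuous functions on a first-countable compact space is Gelfand–Phillips. -/
theorem isGelfandPhillips_continuousMap (K : Type*) [TopologicalSpace K] [CompactSpace K]
    [FirstCountableTopology K] : IsGelfandPhillips 𝕜 C(K, 𝕜) := by
  intro B hB
  obtain ⟨C, hC⟩ := hB.1.exists_norm_le
  let e := ContinuousMap.isometryEquivBoundedOfCompact K 𝕜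
  have h : IsCompact (closure (e '' B)) := by
    refine BoundedContinuousFunction.arzela_ascoli (Metric.closedBall 0 C)
      (isCompact_closedBall _ _) _ ?_ ?_
    · rintro _ x ⟨g, hg, rfl⟩
      rw [mem_closedBall_zero_iff]
      exact (g.norm_coe_le_norm x).trans (hC g hg)
    · intro t U hU
      filter_upwards [hB.equicontinuous t U hU] with s hs
      rintro ⟨_, g, hg, rfl⟩
      exact hs ⟨g, hg⟩
  have h2 : e '' closure B = closure (e '' B) := e.toHomeomorph.image_closure B
  rw [← h2] at h
  exact e.toHomeomorph.isCompact_image.1 h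

end Limited
-- Failure of the separable `c₀`-extension property
/-- There is a sequence of subintervals of `[0,1]` whose lengths tend to zero and which covers every
point of `[0,1)` infinitely often. -/
theorem exists_seq_intervals_frequently_mem : ∃ p q : ℕ → Set.Icc (0 : ℝ) 1,
    Tendsto (fun n => dist (p n) (q n)) atTop (𝓝 0) ∧
      ∀ x : Set.Icc (0 : ℝ) 1, x < 1 → ∃ᶠ n in atTop, p n ≤ x ∧ x < q n := by
  -- The indices `n = m² + j` with `0 ≤ j ≤ 2m` are those with `n.sqrt = m`; they list the `2m + 1`
  -- equal subintervals of `[0,1]`.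
  let d : ℕ → ℝ := fun n => 2 * n.sqrt + 1
  let k : ℕ → ℕ := fun n => n - n.sqrt * n.sqrt
  have hd : ∀ n, 0 < d n := fun n => by positivity
  have hk : ∀ n, (k n : ℝ) + 1 ≤ d n := fun n => by
    have := Nat.sqrt_le_add n
    have : k n ≤ 2 * n.sqrt := by dsimp only [k]; omega
    simpa [d] using (by exact_mod_cast this : (k n : ℝ) ≤ 2 * n.sqrt)
  refine ⟨fun n => ⟨k n / d n, by have := hd n; positivity,
      (div_le_one (hd n)).2 (by linarith [hk n])⟩,
    fun n => ⟨(k n + 1) / d n, by have := hd n; positivity, (div_le_one (hd n)).2 (hk n)⟩,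
    ?_, ?_⟩
  · have h : Tendsto d atTop atTop := by
      have h1 : Tendsto Nat.sqrt atTop atTop :=
        tendsto_atTop_mono' (f₁ := fun n => n.sqrt) _ (Eventually.of_forall fun _ => le_rfl)
          (tendsto_atTop_atTop.2 fun b => ⟨b * b, fun a ha => Nat.le_sqrt.2 ha⟩)
      exact tendsto_atTop_add_const_right _ _
        ((tendsto_natCast_atTop_atTop.comp h1).const_mul_atTop two_pos)
    refine h.inv_tendsto_atTop.congr fun n => ?_
    have := hd n
    rw [Subtype.dist_eq, Real.dist_eq, ← sub_div, sub_add_cancel_left, abs_div, abs_neg, abs_one,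
      abs_of_pos this, one_div, Pi.inv_apply]
  · intro x hx
    have hx0 : (0 : ℝ) ≤ x := x.2.1
    have hx1 : (x : ℝ) < 1 := hx
    rw [frequently_atTop]
    intro m
    have hm : (0 : ℝ) < 2 * (m : ℝ) + 1 := by positivity
    let j : ℕ := ⌊(x : ℝ) * (2 * (m : ℝ) + 1)⌋₊
    have hj1 : (j : ℝ) ≤ (x : ℝ) * (2 * (m : ℝ) + 1) := Nat.floor_le (by positivity)
    have hj2 : (x : ℝ) * (2 * (m : ℝ) + 1) < (j : ℝ) + 1 := Nat.lt_floor_add_one _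
    have hj : j ≤ m + m := by
      have : (j : ℝ) < 2 * m + 1 := by nlinarith
      have : j < 2 * m + 1 := by exact_mod_cast this
      omega
    have hs : (m * m + j).sqrt = m := Nat.sqrt_add_eq m hj
    have hdm : d (m * m + j) = 2 * m + 1 := by simp only [d, hs]
    have hkm : k (m * m + j) = j := by simp only [k, hs]; omega
    refine ⟨m * m + j, by nlinarith [Nat.le_mul_self m], ?_, ?_⟩
    · rw [← Subtype.coe_le_coe]
      simp only [hdm, hkm]
      exact (div_le_iff₀ hm).2 hj1
    · rw [← Subtype.coe_lt_coe]
      simp only [hdm, hkm]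
      exact (lt_div_iff₀ hm).2 hj2

namespace SplitInterval

variable (𝕜 : Type*) [RCLike 𝕜]

/-- The continuous indicator function of the points of the split interval below `(x, 0)`. -/
noncomputable def indicatorIic (x : Set.Icc (0 : ℝ) 1) : C(SplitInterval, 𝕜) where
  toFun := (Set.Iic (mk x 0)).indicator 1
  continuous_toFun := (continuous_one).indicator fun a ha => by
    simp [(isClopen_Iic_mk_zero x).frontier_eq] at ha

theorem indicatorIic_mk_zero (x y : Set.Icc (0 : ℝ) 1) [Decidable (y ≤ x)] :
    indicatorIic 𝕜 x (mk y 0) = if y ≤ x then 1 else 0 := by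
  have : mk y 0 ≤ mk x 0 ↔ y ≤ x := by simp [mk_le_mk, ← le_iff_lt_or_eq]
  classical
  simp [indicatorIic, Set.indicator_apply, this]

/-- Composition with the projection of the split interval onto the unit interval. -/
noncomputable def pullback : C(Set.Icc (0 : ℝ) 1, 𝕜) →ₗ[𝕜] C(SplitInterval, 𝕜) :=
  (ContinuousMap.compRightAlgHom 𝕜 𝕜 ⟨proj, continuous_proj⟩).toLinearMap

@[simp]
theorem pullback_apply (g : C(Set.Icc (0 : ℝ) 1, 𝕜)) (z : SplitInterval) :
    pullback 𝕜 g z = g (proj z) := rfl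

theorem isometry_pullback : Isometry (pullback 𝕜) := by
  refine AddMonoidHomClass.isometry_of_norm _ fun g => le_antisymm ?_ ?_
  · exact (ContinuousMap.norm_le _ (norm_nonneg _)).2 fun z => g.norm_coe_le_norm (proj z)
  · refine (ContinuousMap.norm_le _ (norm_nonneg _)).2 fun x => ?_
    simpa using (pullback 𝕜 g).norm_coe_le_norm (mk x 0)

theorem isClosed_range_pullback :
    IsClosed (LinearMap.range (pullback 𝕜) : Set C(SplitInterval, 𝕜)) := by
  rw [LinearMap.coe_range]
  exact (isometry_pullback 𝕜).isClosedEmbedding.isClosed_range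

theorem separableSpace_range_pullback :
    TopologicalSpace.SeparableSpace (LinearMap.range (pullback 𝕜)) := by
  have := TopologicalSpace.isSeparable_range (isometry_pullback 𝕜).continuous
  rw [← LinearMap.coe_range] at this
  exact this.separableSpace

variable {𝕜}

/-- For each `δ > 0`, the indicator of the points below `(x, 0)` differs from the pullback of a
continuous function by a function bounded by one and vanishing outside `[x, x + δ)`. -/
theorem exists_indicatorIic_sub_pullback (x : Set.Icc (0 : ℝ) 1) {δ : ℝ} (hδ : 0 < δ) :
    ∃ g : C(Set.Icc (0 : ℝ) 1, 𝕜), ∀ z, ‖(indicatorIic 𝕜 x - pullback 𝕜 g) z‖ ≤ 1 ∧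
      ((indicatorIic 𝕜 x - pullback 𝕜 g) z ≠ 0 → x ≤ proj z ∧ (proj z : ℝ) < x + δ) := by
  -- Equal to `1` up to `x`, then falling linearly to `0` at `x + δ`.
  let φ : ℝ → ℝ := fun y => max 0 (min 1 (1 - (y - x) / δ))
  have hφ : Continuous φ := by fun_prop
  have hφ0 : ∀ y, 0 ≤ φ y := fun y => le_max_left _ _
  have hφ1 : ∀ y, φ y ≤ 1 := fun y => max_le zero_le_one (min_le_left _ _)
  have hφx : ∀ y ≤ (x : ℝ), φ y = 1 := fun y hy => by
    have : (y - x) / δ ≤ 0 := div_nonpos_of_nonpos_of_nonneg (by linarith) hδ.le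
    simp only [φ]
    rw [min_eq_left (by linarith), max_eq_right zero_le_one]
  have hφδ : ∀ y, x + δ ≤ y → φ y = 0 := fun y hy => by
    have : 1 ≤ (y - x) / δ := (one_le_div hδ).2 (by linarith)
    exact max_eq_left ((min_le_right _ _).trans (by linarith))
  refine ⟨⟨fun y => (φ y : 𝕜), by fun_prop⟩, fun z => ?_⟩
  simp only [ContinuousMap.sub_apply, pullback_apply, ContinuousMap.coe_mk]
  by_cases hz : z ≤ mk x 0
  · have h1 : indicatorIic 𝕜 x z = 1 := Set.indicator_of_mem (s := Set.Iic (mk x 0)) hz _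
    have h2 : (proj z : ℝ) ≤ x := not_lt.1 fun h =>
      lt_asymm (mk_one_lt_iff.2 h) (lt_mk_one_iff.2 hz)
    simp [h1, hφx _ h2]
  · have h1 : indicatorIic 𝕜 x z = 0 := Set.indicator_of_notMem (s := Set.Iic (mk x 0)) hz _
    rw [h1, zero_sub, norm_neg, RCLike.norm_ofReal, abs_of_nonneg (hφ0 _)]
    refine ⟨hφ1 _, fun h => ⟨not_lt.1 fun h' => hz (lt_mk_zero_iff.2 h').le, ?_⟩⟩
    by_contra! h'
    exact h (by simp [hφδ _ h'])

/-- The values on the indicators of initial segments of a functional that vanishes on the functions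
pulled back from the unit interval are summable, with sum at most the norm of the functional. -/
theorem sum_norm_apply_indicatorIic_le (ρ : C(SplitInterval, 𝕜) →L[𝕜] 𝕜)
    (hρ : ∀ g, ρ (pullback 𝕜 g) = 0) (s : Finset (Set.Icc (0 : ℝ) 1)) :
    ∑ x ∈ s, ‖ρ (indicatorIic 𝕜 x)‖ ≤ ‖ρ‖ := by
  -- With `δ` below every gap of `s`, the intervals `[x, x + δ)` are disjoint, so the sum `F` below
  -- has norm at most `1`.
  obtain ⟨δ, hδs, hδ⟩ : ∃ δ : ℝ, (∀ x ∈ s, ∀ y ∈ s, x < y → (x : ℝ) + δ < y) ∧ 0 < δ := by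
    have h : ∀ᶠ δ : ℝ in 𝓝[>] 0, ∀ x ∈ s, ∀ y ∈ s, x < y → (x : ℝ) + δ < y := by
      simp only [Filter.eventually_all_finset]
      intro x _ y _
      by_cases hxy : x < y
      · have hpos : (0 : ℝ) < y - x := sub_pos.2 hxy
        filter_upwards [mem_nhdsWithin_of_mem_nhds (Iio_mem_nhds hpos)] with δ hδ _
        linarith [Set.mem_Iio.1 hδ]
      · exact Eventually.of_forall fun _ h => absurd h hxy
    exact (h.and self_mem_nhdsWithin).exists
  choose g hg using fun x => exists_indicatorIic_sub_pullback (𝕜 := 𝕜) x hδ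
  -- Unimodular factors that align the phases, so that `ρ F` is the sum of the norms.
  choose c hc1 hc using fun x => RCLike.exists_norm_eq_mul_self (ρ (indicatorIic 𝕜 x))
  let F : C(SplitInterval, 𝕜) := ∑ x ∈ s, c x • (indicatorIic 𝕜 x - pullback 𝕜 (g x))
  have hF : ‖F‖ ≤ 1 := by
    refine (ContinuousMap.norm_le _ zero_le_one).2 fun z => ?_
    simp only [F, ContinuousMap.coe_sum, Finset.sum_apply, ContinuousMap.smul_apply]
    by_cases hz : ∃ x ∈ s, (indicatorIic 𝕜 x - pullback 𝕜 (g x)) z ≠ 0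
    · obtain ⟨x, hx, hxz⟩ := hz
      rw [Finset.sum_eq_single_of_mem x hx]
      · rw [norm_smul, hc1, one_mul]
        exact (hg x z).1
      · intro y hy hyx
        by_contra hyz
        have h1 := (hg x z).2 hxz
        have h2 := (hg y z).2 (right_ne_zero_of_smul hyz)
        have h1' : (x : ℝ) ≤ proj z := h1.1
        have h2' : (y : ℝ) ≤ proj z := h2.1
        rcases lt_or_gt_of_ne hyx with h | h
        · linarith [hδs y hy x hx h]
        · linarith [hδs x hx y hy h]
    · push Not at hz
      rw [Finset.sum_eq_zero fun x hx => by rw [hz x hx, smul_zero], norm_zero]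
      exact zero_le_one
  have hρF : ρ F = ((∑ x ∈ s, ‖ρ (indicatorIic 𝕜 x)‖ : ℝ) : 𝕜) := by
    simp only [F, map_sum, map_smul, map_sub, hρ, sub_zero, smul_eq_mul, hc]
  have h0 : 0 ≤ ∑ x ∈ s, ‖ρ (indicatorIic 𝕜 x)‖ := Finset.sum_nonneg fun _ _ => norm_nonneg _
  calc ∑ x ∈ s, ‖ρ (indicatorIic 𝕜 x)‖ = ‖ρ F‖ := by
        rw [hρF, RCLike.norm_ofReal, abs_of_nonneg h0]
    _ ≤ ‖ρ‖ := ρ.unit_le_opNorm F hF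

theorem countable_apply_indicatorIic_ne_zero (ρ : C(SplitInterval, 𝕜) →L[𝕜] 𝕜)
    (hρ : ∀ g, ρ (pullback 𝕜 g) = 0) : {x | ρ (indicatorIic 𝕜 x) ≠ 0}.Countable := by
  have h := (summable_of_sum_le (fun _ => norm_nonneg _)
    (sum_norm_apply_indicatorIic_le ρ hρ)).countable_support
  simpa [Function.support] using h

/-- The operator `f ↦ (f (p n, 0) - f (q n, 0))ₙ` from the functions on the split interval pulled
back from the unit interval into `c₀`, for sequences `p`, `q` with `dist (p n) (q n) → 0`. -/
noncomputable def differenceOperator (p q : ℕ → Set.Icc (0 : ℝ) 1)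
    (hpq : Tendsto (fun n => dist (p n) (q n)) atTop (𝓝 0)) :
    LinearMap.range (pullback 𝕜) →L[𝕜] C₀(ℕ, 𝕜) :=
  LinearMap.mkContinuous
    { toFun := fun f =>
        { toFun := fun n => (f : C(SplitInterval, 𝕜)) (mk (p n) 0) -
            (f : C(SplitInterval, 𝕜)) (mk (q n) 0)
          continuous_toFun := continuous_of_discreteTopology
          zero_at_infty' := by
            obtain ⟨_, g, rfl⟩ := f
            rw [cocompact_eq_atTop]
            have hu := CompactSpace.uniformContinuous_of_continuous g.continuous
            have h : Tendsto (fun n => (p n, q n)) atTop (uniformity _) :=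
              tendsto_uniformity_iff_dist_tendsto_zero.2 hpq
            have h2 := tendsto_uniformity_iff_dist_tendsto_zero.1 (Tendsto.comp hu h)
            refine tendsto_zero_iff_norm_tendsto_zero.2 (h2.congr fun n => ?_)
            exact dist_eq_norm _ _ }
      map_add' := fun f g => by
        ext n
        simp only [Submodule.coe_add, ContinuousMap.add_apply, ZeroAtInftyContinuousMap.coe_mk,
          ZeroAtInftyContinuousMap.add_apply]
        exact add_sub_add_comm _ _ _ _
      map_smul' := fun a f => by
        ext n
        exact (smul_sub a _ _).symm }
    2 fun f => by
      rw [← ZeroAtInftyContinuousMap.norm_toBCF_eq_norm]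
      refine (BoundedContinuousFunction.norm_le (by positivity)).2 fun n => ?_
      rw [two_mul]
      exact (norm_sub_le _ _).trans (add_le_add (ContinuousMap.norm_coe_le_norm _ _)
        (ContinuousMap.norm_coe_le_norm _ _))

theorem differenceOperator_apply (p q : ℕ → Set.Icc (0 : ℝ) 1)
    (hpq : Tendsto (fun n => dist (p n) (q n)) atTop (𝓝 0))
    (f : LinearMap.range (pullback 𝕜)) (n : ℕ) :
    differenceOperator p q hpq f n =
      (f : C(SplitInterval, 𝕜)) (mk (p n) 0) - (f : C(SplitInterval, 𝕜)) (mk (q n) 0) := rfl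

theorem not_hasSeparableC0ExtensionProperty :
    ¬ HasSeparableC0ExtensionProperty 𝕜 C(SplitInterval, 𝕜) := by
  classical
  intro h
  obtain ⟨p, q, hpq, hcover⟩ := exists_seq_intervals_frequently_mem
  obtain ⟨T', hT'⟩ := h _ (isClosed_range_pullback 𝕜) (separableSpace_range_pullback 𝕜)
    (differenceOperator p q hpq)
  have hbound : ∀ (n : ℕ) (f : C(SplitInterval, 𝕜)), ‖T' f n‖ ≤ ‖T'‖ * ‖f‖ := fun n f =>
    ((T' f).toBCF.norm_coe_le_norm n).trans (T'.le_opNorm f)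
  let χ : ℕ → C(SplitInterval, 𝕜) →L[𝕜] 𝕜 := fun n => LinearMap.mkContinuous
    { toFun := fun f => T' f n
      map_add' := fun f g => by rw [map_add, ZeroAtInftyContinuousMap.add_apply]
      map_smul' := fun a f => by
        rw [map_smul, ZeroAtInftyContinuousMap.smul_apply, RingHom.id_apply] } ‖T'‖ (hbound n)
  let ρ : ℕ → C(SplitInterval, 𝕜) →L[𝕜] 𝕜 := fun n =>
    χ n - (ContinuousMap.evalCLM 𝕜 (mk (p n) 0) - ContinuousMap.evalCLM 𝕜 (mk (q n) 0))
  have hρ : ∀ n f, ρ n f = T' f n - (f (mk (p n) 0) - f (mk (q n) 0)) := fun n f => rfl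
  have hρ0 : ∀ n g, ρ n (pullback 𝕜 g) = 0 := fun n g => by
    rw [hρ, hT' ⟨_, g, rfl⟩, differenceOperator_apply, sub_self]
  have hcount : (⋃ n, {x | ρ n (indicatorIic 𝕜 x) ≠ 0}).Countable :=
    Set.countable_iUnion fun n => countable_apply_indicatorIic_ne_zero (ρ n) (hρ0 n)
  -- The point `1` is excluded because no interval `[p n, q n)` contains it.
  obtain ⟨x, hx⟩ : ∃ x, x ∉ (⋃ n, {x | ρ n (indicatorIic 𝕜 x) ≠ 0}) ∪ {1} := by
    by_contra! hall
    have huniv : (Set.univ : Set (Set.Icc (0 : ℝ) 1)).Countable :=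
      (hcount.union (Set.countable_singleton 1)).mono fun x _ => hall x
    have : (Set.Icc (0 : ℝ) 1).Countable :=
      Set.countable_coe_iff.1 (Set.countable_univ_iff.1 huniv)
    rw [← Cardinal.le_aleph0_iff_set_countable, Cardinal.mk_Icc_real zero_lt_one] at this
    exact this.not_gt Cardinal.aleph0_lt_continuum
  simp only [Set.mem_union, Set.mem_iUnion, Set.mem_ofPred_eq, Set.mem_singleton_iff, not_or,
    not_exists, not_not] at hx
  have hlim : Tendsto (fun n => T' (indicatorIic 𝕜 x) n) atTop (𝓝 0) :=
    cocompact_eq_atTop (α := ℕ) ▸ (T' (indicatorIic 𝕜 x)).zero_at_infty'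
  have hev := hlim.norm.eventually_lt_const (u := 1) (by simp)
  obtain ⟨n, ⟨hpx, hxq⟩, hn⟩ :=
    ((hcover x (lt_of_le_of_ne x.2.2 hx.2)).and_eventually hev).exists
  have h0 := hx.1 n
  rw [hρ, indicatorIic_mk_zero, indicatorIic_mk_zero, if_pos hpx, if_neg hxq.not_ge, sub_zero,
    sub_eq_zero] at h0
  rw [h0, norm_one] at hn
  exact lt_irrefl _ hn

end SplitInterval

theorem mainTheorem7 (𝕜 : Type*) [RCLike 𝕜] :
    IsGelfandPhillips 𝕜 C(SplitInterval, 𝕜) ∧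
      ¬ HasSeparableC0ExtensionProperty 𝕜 C(SplitInterval, 𝕜) :=
  ⟨isGelfandPhillips_continuousMap SplitInterval,
    SplitInterval.not_hasSeparableC0ExtensionProperty⟩
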